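/- Let $(X,\Sigma,\mathfrak m)$ be a probability space and let $\mathbb B$ be a real Banach space. Then $\mathbb B$ is reflexive if and only if the Lebesgue–Bochner space $L^p(\mathfrak m;\mathbb B)$ is reflexive for every $p\in(1,\infty)$. Here a real Banach space $E$ is called reflexive if the canonical embedding $j_E\colon E\to E''$, $\langle j_E(v),\omega\rangle=\langle\omega,v\rangle$ for $v\in E$ and $\omega\in E'$, is surjective, and $L^p(\mathfrak m;\mathbb B)$ is the Banach space of $\mathfrak m$-a.e. equivalence classes of strongly measurable maps $v\colon X\to\mathbb B$ with $\|v\|_{L^p}^p=\int\|v(x)\|_{\mathbb B}^p\,d\mathfrak m(x)<\infty$. -/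

import Mathlib

open MeasureTheory
open scoped ENNReal

/-- A real normed space is reflexive if the canonical (James) embedding
`v ↦ (ω ↦ ω v)` into its topological bidual is surjective. The embedding is always a linear
isometry, so this says that it is an isometric isomorphism. -/
def IsReflexiveSpace (E : Type*) [NormedAddCommGroup E] [NormedSpace ℝ E] : Prop :=
  Function.Surjective (NormedSpace.inclusionInDoubleDual ℝ E)

/-! Reflexivity passes from `B` to `Lp B p m` by a reduction to separable `B`. By
`isReflexiveSpace_of_forall_bounded_seq` it is enough to treat one bounded sequence at a time. Such
a sequence takes its values in a closed separable subspace of `B`, which is again reflexive.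

If `B` is separable and reflexive, its dual is separable, and `lpDualPairing_surjective` represents
every functional on `Lp B p m` by an element of `Lp (StrongDual ℝ B) q m`. Using this for `(B, p)`
and for `(StrongDual ℝ B, q)` turns an element of the bidual into an `Lp` function with values in
the bidual of `B`, which is pulled back pointwise through the canonical embedding.

The representation rests on scalar Radon–Nikodym densities in countably many directions. Their
maximal function is in `L^q` (`lintegral_iSup_density_rpow_le`), and Helly's theorem assembles them
into a functional at almost every point.

Conversely, `p = 2` suffices: constants embed `B` into `Lp B 2 m`, and integration against the
probability measure is a left inverse. -/

/-! ### Hahn–Banach separation, closed subspaces and Helly's theorem. -/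

theorem exists_dual_eq_zero_of_notMem {E : Type*} [NormedAddCommGroup E] [NormedSpace ℝ E]
    (S : Submodule ℝ E) (hS : IsClosed (S : Set E)) {x : E} (hx : x ∉ S) :
    ∃ f : StrongDual ℝ E, (∀ y ∈ S, f y = 0) ∧ f x ≠ 0 := by
  obtain ⟨f, u, hf, hu⟩ := geometric_hahn_banach_closed_point (S.convex) hS
    (show x ∉ (S : Set E) from hx)
  have h0 : 0 < u := by simpa using hf 0 S.zero_mem
  refine ⟨f, fun y hy => ?_, (h0.trans hu).ne'⟩
  by_contra h
  -- The multiple of `y` on which `f` equals `u`, against the strict bound on `S`.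
  have := hf ((u / f y) • y) (S.smul_mem _ hy)
  rw [map_smul, smul_eq_mul, div_mul_cancel₀ _ h] at this
  exact this.false

/-- A closed subspace of a reflexive space is reflexive. -/
theorem IsReflexiveSpace.submodule {E : Type*} [NormedAddCommGroup E] [NormedSpace ℝ E]
    (hE : IsReflexiveSpace E) (S : Submodule ℝ E) (hS : IsClosed (S : Set E)) :
    IsReflexiveSpace S := by
  intro Φ
  obtain ⟨x, hx⟩ := hE (Φ.comp (ContinuousLinearMap.precomp ℝ S.subtypeL))
  have hx' : ∀ f : StrongDual ℝ E, f x = Φ (f.comp S.subtypeL) := fun f => by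
    rw [← NormedSpace.dual_def, hx]; rfl
  have hxS : x ∈ S := by
    by_contra h
    obtain ⟨f, hf, hfx⟩ := exists_dual_eq_zero_of_notMem S hS h
    apply hfx
    have : f.comp S.subtypeL = 0 := by ext y; exact hf y y.2
    rw [hx', this, map_zero]
  refine ⟨⟨x, hxS⟩, ?_⟩
  ext g
  obtain ⟨f, hf, -⟩ := exists_extension_norm_eq S g
  have hfg : f.comp S.subtypeL = g := by ext y; exact hf y
  rw [NormedSpace.dual_def, ← hfg, ← hx']
  rfl

/-- **Helly's theorem**: finitely many values of an element of the bidual are approximated by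
a vector of no larger norm. -/
theorem exists_norm_le_forall_abs_sub_lt {E : Type*} [NormedAddCommGroup E] [NormedSpace ℝ E]
    (Φ : StrongDual ℝ (StrongDual ℝ E)) (s : Finset (StrongDual ℝ E)) {ε : ℝ} (hε : 0 < ε) :
    ∃ x : E, ‖x‖ ≤ ‖Φ‖ ∧ ∀ f ∈ s, |f x - Φ f| < ε := by
  classical
  let T : E →L[ℝ] (s → ℝ) := ContinuousLinearMap.pi fun f => f.1
  let C : Set (s → ℝ) := closure (T '' Metric.closedBall 0 ‖Φ‖)
  by_cases hmem : (fun f : s => Φ f.1) ∈ C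
  · obtain ⟨_, ⟨x, hx, rfl⟩, hd⟩ := Metric.mem_closure_iff.1 hmem ε hε
    refine ⟨x, by simpa using hx, fun f hf => ?_⟩
    have := (dist_pi_lt_iff hε).1 hd ⟨f, hf⟩
    rw [dist_comm, Real.dist_eq] at this
    exact this
  · exfalso
    have hconv : Convex ℝ C := ((convex_closedBall (0 : E) ‖Φ‖).linear_image T.toLinearMap).closure
    obtain ⟨a, u, ha, hu⟩ := geometric_hahn_banach_closed_point hconv isClosed_closure hmem
    -- The separating functional pulled back along `T`: it is below `u` on the ball of radius `‖Φ‖`,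
    -- so `‖Φ‖ * ‖g‖ ≤ u`, while `Φ g` exceeds `u`.
    let g : StrongDual ℝ E := ∑ f : s, a (Pi.single f 1) • f.1
    have key : ∀ z : s → ℝ, a z = ∑ f : s, z f * a (Pi.single f 1) := fun z => by
      have := LinearMap.pi_apply_eq_sum_univ a.toLinearMap z
      simp only [ContinuousLinearMap.coe_coe, smul_eq_mul] at this
      rw [this]
      refine Finset.sum_congr rfl fun i _ => ?_
      congr 2
      ext j
      simp [Pi.single_apply, eq_comm]
    have hg : ∀ x, g x = a (T x) := fun x => by
      rw [key]
      simp [g, T, mul_comm]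
    have hΦ : Φ g = a fun f : s => Φ f.1 := by
      rw [key]
      simp [g, mul_comm]
    have hball : ∀ x : E, ‖x‖ ≤ ‖Φ‖ → g x < u := fun x hx => by
      rw [hg]
      exact ha _ (subset_closure ⟨x, by simpa using hx, rfl⟩)
    have h0 : 0 < u := by simpa using hball 0 (by rw [norm_zero]; exact norm_nonneg Φ)
    rcases eq_or_ne Φ 0 with rfl | hΦ0
    · rw [← hΦ] at hu
      simp only [zero_apply] at hu
      exact h0.not_gt hu
    have hpos : 0 < ‖Φ‖ := (norm_pos_iff (a := Φ)).2 hΦ0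
    have hle : ‖g‖ ≤ u / ‖Φ‖ := by
      refine ContinuousLinearMap.opNorm_le_of_unit_norm (by positivity) fun x hx => ?_
      have h1 := hball (‖Φ‖ • x) (by rw [norm_smul, Real.norm_of_nonneg hpos.le, hx, mul_one])
      have h2 := hball (-(‖Φ‖ • x)) (by
        rw [norm_neg, norm_smul, Real.norm_of_nonneg hpos.le, hx, mul_one])
      rw [map_neg, map_smul, smul_eq_mul] at h2
      rw [map_smul, smul_eq_mul] at h1
      have h3 : |g x| * ‖Φ‖ = |‖Φ‖ * g x| := by rw [abs_mul, abs_of_pos hpos, mul_comm]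
      rw [le_div_iff₀ hpos, Real.norm_eq_abs, h3, abs_le]
      constructor <;> linarith
    have := Φ.le_opNorm g
    rw [hΦ, Real.norm_eq_abs] at this
    have h2 : ‖Φ‖ * ‖g‖ ≤ u := by
      rw [le_div_iff₀ hpos] at hle; linarith
    linarith [le_abs_self (a fun f : s => Φ f.1)]

/-! ### A sequential criterion for reflexivity. -/

theorem exists_dual_norm_le_eqOn {F : Type*} [NormedAddCommGroup F] [NormedSpace ℝ F]
    (Φ : StrongDual ℝ F) (V : Submodule ℝ F) {θ : ℝ} (hθ : 0 ≤ θ)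
    (h : ∀ f ∈ V, ‖f‖ ≤ 1 → Φ f ≤ θ) :
    ∃ g : StrongDual ℝ F, ‖g‖ ≤ θ ∧ ∀ f ∈ V, g f = Φ f := by
  obtain ⟨g, hg, hgn⟩ := exists_extension_norm_eq V (Φ.comp V.subtypeL)
  refine ⟨g, hgn.trans_le ?_, fun f hf => hg ⟨f, hf⟩⟩
  refine ContinuousLinearMap.opNorm_le_of_unit_norm hθ fun f hf => ?_
  have h1 := h f f.2 hf.le
  have h2 := h (-f) (V.neg_mem f.2) (by rw [norm_neg]; exact hf.le)
  rw [map_neg] at h2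
  rw [Real.norm_eq_abs, abs_le]
  exact ⟨neg_le.1 h2, h1⟩

/-- Completeness makes the canonical image of `E` closed, so `Φ` lies at positive distance from it;
`θ` is half that distance. If the claim failed for `t`, then `Φ` restricted to the annihilator of
`t` would extend to some `g` with `‖g‖ ≤ θ`. Then `Φ - g` vanishes on that annihilator, so it is a
combination of evaluations at points of `t`, and `Φ` is within `θ` of the image. -/
theorem exists_pos_forall_finset_dual_vanishing {E : Type*} [NormedAddCommGroup E]
    [NormedSpace ℝ E] [CompleteSpace E] {Φ : StrongDual ℝ (StrongDual ℝ E)}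
    (hΦ : Φ ∉ Set.range (NormedSpace.inclusionInDoubleDual ℝ E)) :
    ∃ θ > 0, ∀ t : Finset E, ∃ f : StrongDual ℝ E, ‖f‖ ≤ 1 ∧ θ ≤ Φ f ∧ ∀ x ∈ t, f x = 0 := by
  set R := Set.range (NormedSpace.inclusionInDoubleDual ℝ E)
  have hR : IsClosed R :=
    (Isometry.isClosedEmbedding (α := E) (γ := StrongDual ℝ (StrongDual ℝ E))
      (NormedSpace.inclusionInDoubleDualLi ℝ (E := E)).isometry).isClosed_range
  have hne : R.Nonempty := Set.range_nonempty _
  have hd : 0 < Metric.infDist Φ R := (hR.notMem_iff_infDist_pos hne).1 hΦ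
  refine ⟨Metric.infDist Φ R / 2, by positivity, fun t => ?_⟩
  set θ := Metric.infDist Φ R / 2 with hθ
  by_contra! hcon
  have hcon' : ∀ f : StrongDual ℝ E, ‖f‖ ≤ 1 → (∀ x ∈ t, f x = 0) → Φ f < θ := by
    intro f h1 h2
    by_contra! h3
    obtain ⟨x, hx, hx0⟩ := hcon f h1 h3
    exact hx0 (h2 x hx)
  let V : Submodule ℝ (StrongDual ℝ E) :=
    ⨅ x : t, LinearMap.ker (NormedSpace.inclusionInDoubleDual ℝ E x.1).toLinearMap
  have hV : ∀ f : StrongDual ℝ E, f ∈ V ↔ ∀ x ∈ t, f x = 0 := fun f => by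
    simp [V, Submodule.mem_iInf]
  obtain ⟨g, hgn, hg⟩ := exists_dual_norm_le_eqOn Φ V (θ := θ) (by positivity)
    fun f hf hn => (hcon' f hn ((hV f).1 hf)).le
  have hspan : (Φ - g).toLinearMap ∈ Submodule.span ℝ (Set.range fun x : t =>
      (NormedSpace.inclusionInDoubleDual ℝ E x.1).toLinearMap) := by
    refine mem_span_of_iInf_ker_le_ker fun f hf => ?_
    have := hg f hf
    simp only [LinearMap.mem_ker, ContinuousLinearMap.coe_coe, sub_apply]
    rw [this, sub_self]
  obtain ⟨c, hc⟩ := (Submodule.mem_span_range_iff_exists_fun ℝ).1 hspan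
  have hmem : Φ - g ∈ R := by
    refine ⟨∑ x : t, c x • x.1, ?_⟩
    ext f
    have := LinearMap.congr_fun hc f
    simp only [LinearMap.sum_apply, LinearMap.smul_apply, ContinuousLinearMap.coe_coe,
      NormedSpace.dual_def] at this
    simp [NormedSpace.dual_def, ← this]
  have h1 := Metric.infDist_le_dist_of_mem (x := Φ) hmem
  rw [dist_eq_norm (a := Φ), sub_sub_cancel Φ g] at h1
  linarith

/-- A Banach space is reflexive if every bounded sequence is the image of a bounded sequence
of a reflexive space. -/
theorem isReflexiveSpace_of_forall_bounded_seq {E : Type*} [NormedAddCommGroup E]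
    [NormedSpace ℝ E] [CompleteSpace E]
    (h : ∀ x : ℕ → E, (∃ C, ∀ n, ‖x n‖ ≤ C) → ∃ (G : Type _) (_ : NormedAddCommGroup G)
      (_ : NormedSpace ℝ G), IsReflexiveSpace G ∧ ∃ (T : G →L[ℝ] E) (y : ℕ → G),
        (∃ C, ∀ n, ‖y n‖ ≤ C) ∧ ∀ n, T (y n) = x n) :
    IsReflexiveSpace E := by
  intro Φ
  by_contra hΦ
  obtain ⟨θ, hθ, hvan⟩ := exists_pos_forall_finset_dual_vanishing (Φ := Φ) hΦ
  -- A triangular system of pairs `(f, x)`: each functional kills all earlier vectors and is at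
  -- least `θ / 2` on all later ones.
  obtain ⟨z, hz, hzr⟩ := exists_seq_of_forall_finset_exists
    (fun z : StrongDual ℝ E × E => ‖z.1‖ ≤ 1 ∧ θ ≤ Φ z.1 ∧ ‖z.2‖ ≤ ‖Φ‖)
    (fun z w => w.1 z.2 = 0 ∧ θ / 2 ≤ z.1 w.2) (by
      classical
      intro s hs
      obtain ⟨f, hf1, hf2, hf3⟩ := hvan (s.image Prod.snd)
      obtain ⟨x, hx, hxs⟩ := exists_norm_le_forall_abs_sub_lt Φ (s.image Prod.fst) (half_pos hθ)
      refine ⟨(f, x), ⟨hf1, hf2, hx⟩, fun w hw => ⟨hf3 _ (Finset.mem_image_of_mem _ hw), ?_⟩⟩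
      have h1 := (abs_lt.1 (hxs _ (Finset.mem_image_of_mem Prod.fst hw))).1
      have h2 := (hs w hw).2.1
      simp only
      linarith)
  obtain ⟨G, _, _, hG, T, y, ⟨C, hC⟩, hT⟩ := h (fun n => (z n).2) ⟨_, fun n => (hz n).2.2⟩
  -- Banach–Alaoglu along a free ultrafilter; reflexivity of `G` turns the weak-star limit into a
  -- weak limit `w` of `y` in `G`.
  obtain ⟨Ψ, -, hΨ⟩ := isCompact_iff_ultrafilter_le_nhds.1
    (WeakDual.isCompact_closedBall (𝕜 := ℝ) (E := StrongDual ℝ G) 0 C)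
    ((Filter.hyperfilter ℕ).map fun n =>
      StrongDual.toWeakDual (NormedSpace.inclusionInDoubleDual ℝ G (y n))) (by
      rw [Filter.le_principal_iff]
      refine Filter.mem_map.2 (Filter.univ_mem' fun n => ?_)
      simpa using (NormedSpace.double_dual_bound ℝ G (y n)).trans (hC n))
  obtain ⟨w, hw⟩ := hG (WeakDual.toStrongDual Ψ)
  have htend : ∀ g : StrongDual ℝ G,
      Filter.Tendsto (fun n => g (y n)) (Filter.hyperfilter ℕ) (nhds (g w)) := by
    intro g
    have h1 : Filter.Tendsto (fun Ξ : WeakDual ℝ (StrongDual ℝ G) => Ξ g) (nhds Ψ) (nhds (Ψ g)) :=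
      (WeakDual.eval_continuous g).tendsto Ψ
    have h2 : Ψ g = g w := by
      rw [← NormedSpace.dual_def, hw]; rfl
    rw [← h2]
    exact h1.comp hΨ
  have hlow : ∀ m, θ / 2 ≤ (z m).1 (T w) := by
    intro m
    refine ge_of_tendsto (htend ((z m).1.comp T)) ?_
    filter_upwards [Nat.hyperfilter_le_atTop (Filter.eventually_gt_atTop m)] with n hn
    simpa [hT] using (hzr m n hn).2
  -- The weak limit lies in the norm-closed span of `y`, so `w` is close to some `v` in the span.
  -- Late functionals kill `T v` yet are at least `θ / 2` on `T w`.
  have hwmem : w ∈ (Submodule.span ℝ (Set.range y)).topologicalClosure := by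
    by_contra hw
    obtain ⟨g, hg, hgw⟩ := exists_dual_eq_zero_of_notMem _
      (Submodule.isClosed_topologicalClosure _) hw
    refine hgw (tendsto_nhds_unique (htend g) ?_)
    have : (fun n => g (y n)) = fun _ => 0 := funext fun n =>
      hg _ (Submodule.le_topologicalClosure _ (Submodule.subset_span ⟨n, rfl⟩))
    rw [this]
    exact tendsto_const_nhds
  have hδ : 0 < θ / 2 / (‖T‖ + 1) := by positivity
  obtain ⟨v, hv, hvw⟩ := Metric.mem_closure_iff.1 hwmem _ hδ
  have hev : ∃ N, ∀ n ≥ N, (z n).1 (T v) = 0 := by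
    refine Submodule.span_induction (p := fun v _ => ∃ N, ∀ n ≥ N, (z n).1 (T v) = 0)
      ?_ ⟨0, by simp⟩ ?_ ?_ hv
    · rintro _ ⟨k, rfl⟩
      exact ⟨k + 1, fun n hn => by rw [hT]; exact (hzr k n hn).1⟩
    · rintro a b - - ⟨N, hN⟩ ⟨M, hM⟩
      exact ⟨max N M, fun n hn => by
        rw [map_add, map_add, hN n (le_of_max_le_left hn), hM n (le_of_max_le_right hn), add_zero]⟩
    · rintro c a - ⟨N, hN⟩
      exact ⟨N, fun n hn => by simp [hN n hn]⟩
  obtain ⟨N, hN⟩ := hev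
  have h1 : (z N).1 (T w) = (z N).1 (T (w - v)) := by
    rw [map_sub, map_sub, hN N le_rfl, sub_zero]
  have h2 : |(z N).1 (T (w - v))| ≤ 1 * (‖T‖ * ‖w - v‖) :=
    ((z N).1.le_opNorm _).trans (by
      gcongr
      · exact (hz N).1
      · exact T.le_opNorm _)
  rw [dist_eq_norm, lt_div_iff₀ (by positivity)] at hvw
  have h3 := hlow N
  have h4 := le_abs_self ((z N).1 (T (w - v)))
  nlinarith [norm_nonneg (w - v), norm_nonneg T]

/-! ### Separability of a space and of its dual. -/

/-- A normed space with separable dual is separable. -/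
theorem separableSpace_of_separableSpace_dual (E : Type*) [NormedAddCommGroup E]
    [NormedSpace ℝ E] [TopologicalSpace.SeparableSpace (StrongDual ℝ E)] :
    TopologicalSpace.SeparableSpace E := by
  have hx : ∀ f : StrongDual ℝ E, ∃ x : E, ‖x‖ ≤ 1 ∧ ‖f‖ / 2 ≤ ‖f x‖ := by
    intro f
    rcases eq_or_ne f 0 with rfl | hf
    · exact ⟨0, by simp⟩
    have hpos := norm_pos_iff.2 hf
    obtain ⟨x, hx1, hx2⟩ := f.exists_lt_apply_of_lt_opNorm (half_lt_self hpos)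
    exact ⟨x, hx1.le, hx2.le⟩
  choose x hx1 hx2 using hx
  let S : Submodule ℝ E := (Submodule.span ℝ
    (Set.range fun n => x (TopologicalSpace.denseSeq (StrongDual ℝ E) n))).topologicalClosure
  have hS : S = ⊤ := by
    refine (Submodule.eq_top_iff').2 fun v => ?_
    by_contra hv
    obtain ⟨f, hf, hfv⟩ := exists_dual_eq_zero_of_notMem S
      (Submodule.isClosed_topologicalClosure _) hv
    have hf0 : 0 < ‖f‖ := norm_pos_iff.2 (by rintro rfl; simp at hfv)
    obtain ⟨n, hn⟩ := (TopologicalSpace.denseRange_denseSeq (StrongDual ℝ E)).exists_dist_lt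
      f (show 0 < ‖f‖ / 4 by positivity)
    set g := TopologicalSpace.denseSeq (StrongDual ℝ E) n
    have h0 : f (x g) = 0 := hf _ (Submodule.le_topologicalClosure _
      (Submodule.subset_span ⟨n, rfl⟩))
    have h1 : ‖g (x g)‖ ≤ ‖f - g‖ := by
      have := (f - g).le_opNorm (x g)
      rw [sub_apply, h0, zero_sub, norm_neg] at this
      exact this.trans (mul_le_of_le_one_right (norm_nonneg _) (hx1 g))
    have h2 := hx2 g
    rw [dist_eq_norm] at hn
    have h3 := norm_sub_norm_le f g
    linarith
  have hsep : TopologicalSpace.IsSeparable (S : Set E) :=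
    ((Set.countable_range _).isSeparable.span).closure
  rw [hS] at hsep
  exact TopologicalSpace.isSeparable_univ_iff.1 (by simpa using hsep)

/-- Reflexivity makes the bidual a continuous image of `E`, hence separable; separability then
descends from the bidual to the dual. -/
theorem IsReflexiveSpace.separableSpace_dual {E : Type*} [NormedAddCommGroup E]
    [NormedSpace ℝ E] [TopologicalSpace.SeparableSpace E] (hE : IsReflexiveSpace E) :
    TopologicalSpace.SeparableSpace (StrongDual ℝ E) := by
  have : TopologicalSpace.SeparableSpace (StrongDual ℝ (StrongDual ℝ E)) :=
    hE.denseRange.separableSpace (NormedSpace.inclusionInDoubleDual ℝ E).continuous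
  exact separableSpace_of_separableSpace_dual _

/-! ### Indicator classes and scalar densities. -/

section Density

variable {X : Type*} [MeasurableSpace X] {m : Measure X} [IsFiniteMeasure m]
  {B : Type*} [NormedAddCommGroup B] {p : ℝ≥0∞}

/-- The `Lp` class of the function equal to `b` on `A` and to `0` elsewhere. -/
noncomputable abbrev lpIndicator (m : Measure X) [IsFiniteMeasure m] (p : ℝ≥0∞) {A : Set X}
    (hA : MeasurableSet A) (b : B) : Lp B p m :=
  indicatorConstLp p hA (measure_ne_top m A) b

theorem lpIndicator_biUnion {ι : Type*} {A : ι → Set X} (hA : ∀ i, MeasurableSet (A i))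
    (hd : Pairwise (Function.onFun Disjoint A)) (s : Finset ι) (b : B) :
    lpIndicator m p (Finset.measurableSet_biUnion s fun i _ => hA i) b =
      ∑ i ∈ s, lpIndicator m p (hA i) b := by
  classical
  induction s using Finset.induction_on with
  | empty =>
    simp only [Finset.sum_empty, Finset.notMem_empty, Set.iUnion_of_empty, Set.iUnion_empty]
    exact indicatorConstLp_empty
  | insert i s hi ih =>
    rw [Finset.sum_insert hi, ← ih, ← indicatorConstLp_disjoint_union]
    · congr 1
      exact Finset.set_biUnion_insert i s A
    · exact Set.disjoint_iUnion₂_right.2 fun j hj => hd (by rintro rfl; exact hi hj)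

/-- Finite measure makes the tails of the union small in measure, and `p ≠ ∞` turns this into norm
convergence. This is the countable additivity of `A ↦ Λ (1_A b)`. -/
theorem hasSum_lpIndicator_iUnion [Fact (1 ≤ p)] (hp : p ≠ ∞) {A : ℕ → Set X}
    (hA : ∀ i, MeasurableSet (A i)) (hd : Pairwise (Function.onFun Disjoint A)) (b : B) :
    HasSum (fun i => lpIndicator m p (hA i) b) (lpIndicator m p (MeasurableSet.iUnion hA) b) := by
  have : (fun s : Finset ℕ => ∑ i ∈ s, lpIndicator m p (hA i) b) = fun s =>
      lpIndicator m p (Finset.measurableSet_biUnion s fun i _ => hA i) b :=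
    funext fun s => (lpIndicator_biUnion hA hd s b).symm
  rw [HasSum, this]
  refine tendsto_indicatorConstLp_set hp ?_
  have hsub : ∀ s : Finset ℕ, (⋃ i ∈ s, A i) ⊆ ⋃ i, A i := fun s =>
    Set.iUnion₂_subset fun i _ => Set.subset_iUnion A i
  have hmono : Monotone fun s : Finset ℕ => ⋃ i ∈ s, A i := fun s t hst =>
    Set.biUnion_mono hst fun _ _ => le_rfl
  have hU : ⋃ s : Finset ℕ, ⋃ i ∈ s, A i = ⋃ i, A i :=
    (Set.iUnion_subset hsub).antisymm
      (Set.iUnion_subset fun i => Set.subset_iUnion_of_subset {i} (by simp))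
  have h1 := tendsto_measure_iUnion_atTop (μ := m) hmono
  rw [hU] at h1
  have h2 : ∀ s : Finset ℕ, m (symmDiff (⋃ i ∈ s, A i) (⋃ i, A i)) =
      m (⋃ i, A i) - m (⋃ i ∈ s, A i) := fun s => by
    rw [symmDiff_of_le (hsub s)]
    exact measure_sdiff (hsub s) (Finset.measurableSet_biUnion s fun i _ => hA i).nullMeasurableSet
      (measure_ne_top m _)
  simp_rw [h2]
  have h3 := ENNReal.Tendsto.sub (tendsto_const_nhds (x := m (⋃ i, A i))
    (f := (Filter.atTop : Filter (Finset ℕ)))) h1 (Or.inl (measure_ne_top m _))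
  rwa [tsub_self] at h3

/-- Scalar Radon-Nikodym densities of a functional on a Lebesgue-Bochner space. -/
theorem exists_density [NormedSpace ℝ B] [Fact (1 ≤ p)] (hp : p ≠ ∞)
    (Λ : StrongDual ℝ (Lp B p m)) (b : B) :
    ∃ γ : X → ℝ, Measurable γ ∧ Integrable γ m ∧ ∀ (A : Set X) (hA : MeasurableSet A),
      Λ (lpIndicator m p hA b) = ∫ x in A, γ x ∂m := by
  classical
  let ν : SignedMeasure X :=
    { measureOf' := fun A => if hA : MeasurableSet A then Λ (lpIndicator m p hA b) else 0
      empty' := by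
        rw [dif_pos MeasurableSet.empty]
        have : lpIndicator m p MeasurableSet.empty b = 0 := indicatorConstLp_empty
        rw [this, map_zero]
      not_measurable' := fun A hA => dif_neg hA
      m_iUnion' := fun A hA hd => by
        simp only [hA, MeasurableSet.iUnion hA, dif_pos]
        exact (hasSum_lpIndicator_iUnion hp hA hd b).mapL Λ }
  have hν : ∀ A (hA : MeasurableSet A), ν A = Λ (lpIndicator m p hA b) := fun A hA => dif_pos hA
  have hac : ν ≪ᵥ m.toENNRealVectorMeasure := by
    refine VectorMeasure.AbsolutelyContinuous.mk fun A hA h0 => ?_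
    rw [Measure.toENNRealVectorMeasure_apply_measurable hA] at h0
    rw [hν A hA]
    have : lpIndicator m p hA b = 0 := by
      rw [← norm_eq_zero, norm_indicatorConstLp (zero_lt_one.trans_le Fact.out).ne' hp,
        measureReal_def, h0, ENNReal.toReal_zero, Real.zero_rpow, mul_zero]
      exact one_div_ne_zero (ENNReal.toReal_ne_zero.2
        ⟨(zero_lt_one.trans_le (Fact.out : 1 ≤ p)).ne', hp⟩)
    rw [this, map_zero]
  refine ⟨ν.rnDeriv m, SignedMeasure.measurable_rnDeriv _ _, SignedMeasure.integrable_rnDeriv _ _,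
    fun A hA => ?_⟩
  rw [← hν A hA, ← withDensityᵥ_apply (SignedMeasure.integrable_rnDeriv _ _) hA,
    SignedMeasure.withDensityᵥ_rnDeriv_eq _ _ hac]


theorem coeFn_sum_lpIndicator {ι : Type*} {A : ι → Set X} (hA : ∀ i, MeasurableSet (A i))
    (s : Finset ι) (v : ι → B) :
    ⇑(∑ i ∈ s, lpIndicator m p (hA i) (v i)) =ᵐ[m]
      fun x => ∑ i ∈ s, (A i).indicator (fun _ => v i) x := by
  classical
  induction s using Finset.induction_on with
  | empty =>
    simp only [Finset.sum_empty]
    exact Lp.coeFn_zero B p m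
  | insert i s hi ih =>
    rw [Finset.sum_insert hi]
    filter_upwards [Lp.coeFn_add (lpIndicator m p (hA i) (v i))
      (∑ i ∈ s, lpIndicator m p (hA i) (v i)), ih,
      indicatorConstLp_coeFn (p := p) (hs := hA i) (hμs := measure_ne_top m _) (c := v i)]
      with x h1 h2 h3
    rw [h1, Pi.add_apply, h2, h3, Finset.sum_insert hi]

theorem norm_sum_lpIndicator_rpow (hp0 : p ≠ 0) (hp : p ≠ ∞) {ι : Type*} {A : ι → Set X}
    (hA : ∀ i, MeasurableSet (A i)) (hd : Pairwise (Function.onFun Disjoint A))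
    (s : Finset ι) (v : ι → B) :
    ‖∑ i ∈ s, lpIndicator m p (hA i) (v i)‖ ^ p.toReal =
      ∑ i ∈ s, ‖v i‖ ^ p.toReal * m.real (A i) := by
  have hP : 0 < p.toReal := ENNReal.toReal_pos hp0 hp
  have hpt : ∀ x, ‖∑ i ∈ s, (A i).indicator (fun _ => v i) x‖ₑ ^ p.toReal =
      ∑ i ∈ s, (A i).indicator (fun _ => ‖v i‖ₑ ^ p.toReal) x := by
    intro x
    by_cases hx : ∃ i ∈ s, x ∈ A i
    · obtain ⟨i, hi, hxi⟩ := hx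
      have hne : ∀ j ∈ s, j ≠ i → x ∉ A j := fun j _ hji hxj =>
        Set.disjoint_left.1 (hd hji) hxj hxi
      rw [Finset.sum_eq_single_of_mem i hi fun j hj hji =>
          Set.indicator_of_notMem (hne j hj hji) _,
        Finset.sum_eq_single_of_mem i hi fun j hj hji =>
          Set.indicator_of_notMem (hne j hj hji) _,
        Set.indicator_of_mem hxi, Set.indicator_of_mem hxi]
    · push Not at hx
      rw [Finset.sum_eq_zero fun i hi => Set.indicator_of_notMem (hx i hi) _,
        Finset.sum_eq_zero fun i hi => Set.indicator_of_notMem (hx i hi) _, enorm_zero,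
        ENNReal.zero_rpow_of_pos hP]
  rw [Lp.norm_def, ENNReal.toReal_rpow, eLpNorm_congr_ae (coeFn_sum_lpIndicator hA s v),
    eLpNorm_eq_lintegral_rpow_enorm_toReal hp0 hp, ← ENNReal.rpow_mul,
    one_div_mul_cancel hP.ne', ENNReal.rpow_one]
  simp_rw [hpt]
  rw [lintegral_finsetSum _ fun i _ => measurable_const.indicator (hA i), ENNReal.toReal_sum]
  · refine Finset.sum_congr rfl fun i _ => ?_
    rw [lintegral_indicator_const (hA i), ENNReal.toReal_mul, ← ENNReal.toReal_rpow, toReal_enorm]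
    rfl
  · intro i _
    rw [lintegral_indicator_const (hA i)]
    finiteness

/-- `lpIndicator` as a continuous linear map in the vector. -/
noncomputable def lpIndicatorL (m : Measure X) [IsFiniteMeasure m] (B : Type*)
    [NormedAddCommGroup B] [NormedSpace ℝ B] (p : ℝ≥0∞) [Fact (1 ≤ p)] {A : Set X}
    (hA : MeasurableSet A) : B →L[ℝ] Lp B p m :=
  LinearMap.mkContinuous
    { toFun := lpIndicator m p hA
      map_add' := fun _ _ => indicatorConstLp_add.symm
      map_smul' := fun c b => by
        simp only [lpIndicator, indicatorConstLp, RingHom.id_apply, ← MemLp.toLp_const_smul]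
        congr 1
        exact Set.indicator_const_smul A c fun _ => b }
    (m.real A ^ (1 / p.toReal)) fun b => by
      rw [mul_comm]
      exact norm_indicatorConstLp_le (hs := hA) (hμs := measure_ne_top m A)

theorem lpIndicatorL_apply [NormedSpace ℝ B] [Fact (1 ≤ p)] {A : Set X}
    (hA : MeasurableSet A) (b : B) :
    lpIndicatorL m B p hA b = lpIndicator m p hA b :=
  rfl

end Density

/-! ### The `L^q` bound for the maximal density. -/

section Maximal

variable {X : Type*} [MeasurableSpace X] {m : Measure X} [IsFiniteMeasure m]
  {B : Type*} [NormedAddCommGroup B] [NormedSpace ℝ B] {p q : ℝ≥0∞}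

/-- Dividing by `S ^ P⁻¹` leaves `S ^ Q⁻¹ ≤ C`. This closes the duality estimate, where `S` appears
on both sides. -/
theorem Real.le_rpow_of_le_mul_rpow {P Q S C : ℝ} (hPQ : P.HolderConjugate Q) (hS : 0 ≤ S)
    (hC : 0 ≤ C) (h : S ≤ C * S ^ P⁻¹) : S ≤ C ^ Q := by
  rcases hS.eq_or_lt with rfl | hS
  · positivity
  have h1 : S ^ Q⁻¹ ≤ C := by
    have h2 : S ^ P⁻¹ * S ^ Q⁻¹ = S := by
      rw [← Real.rpow_add hS, hPQ.inv_add_inv_eq_one, Real.rpow_one]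
    have h3 : 0 < S ^ P⁻¹ := by positivity
    nlinarith
  calc S = (S ^ Q⁻¹) ^ Q := by
        rw [← Real.rpow_mul hS.le, inv_mul_cancel₀ hPQ.symm.ne_zero, Real.rpow_one]
    _ ≤ C ^ Q := Real.rpow_le_rpow (by positivity) h1 hPQ.symm.nonneg

theorem ENNReal.HolderConjugate.toReal_of_one_lt {p q : ℝ≥0∞} [p.HolderConjugate q] (hp1 : 1 < p)
    (hp : p ≠ ∞) : p.toReal.HolderConjugate q.toReal :=
  ENNReal.HolderConjugate.toReal ((ENNReal.toReal_lt_toReal ENNReal.one_ne_top hp).2 hp1)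

/-- A functional on `Lp B p m` with densities `γ k` in the directions `u k` of norm at most one
controls the `q`-norm of the maximal function of the densities. -/
theorem lintegral_iSup_density_rpow_le [Fact (1 ≤ p)] [p.HolderConjugate q] (hp1 : 1 < p)
    (hp : p ≠ ∞) (Λ : StrongDual ℝ (Lp B p m)) {u : ℕ → B} (hu : ∀ k, ‖u k‖ ≤ 1)
    {γ : ℕ → X → ℝ} (hγ : ∀ k, Measurable (γ k)) (hγi : ∀ k, Integrable (γ k) m)
    (hΛ : ∀ k (A : Set X) (hA : MeasurableSet A),
      Λ (lpIndicator m p hA (u k)) = ∫ x in A, γ k x ∂m) :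
    ∫⁻ x, (⨆ k, ENNReal.ofReal (γ k x)) ^ q.toReal ∂m ≤ ENNReal.ofReal (‖Λ‖ ^ q.toReal) := by
  have hp0 : p ≠ 0 := (zero_lt_one.trans hp1).ne'
  have hPQ : p.toReal.HolderConjugate q.toReal := ENNReal.HolderConjugate.toReal_of_one_lt hp1 hp
  set P := p.toReal
  set Q := q.toReal
  have hP := hPQ.pos
  have hQ := hPQ.symm.pos
  let h : ℕ → X → ℝ≥0∞ := fun N x => (Finset.range (N + 1)).sup fun k => ENNReal.ofReal (γ k x)
  have hmono : ∀ x, Monotone fun N => h N x := fun x N M hNM =>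
    Finset.sup_mono (Finset.range_mono (by omega))
  have hmeas : ∀ N, Measurable (h N) := fun N => by
    simp only [h, Finset.sup_eq_iSup]
    fun_prop
  have hsup : ∀ x, (⨆ k, ENNReal.ofReal (γ k x)) ^ Q = ⨆ N, h N x ^ Q := fun x => by
    have h1 : ⨆ k, ENNReal.ofReal (γ k x) = ⨆ N, h N x := by
      apply le_antisymm
      · exact iSup_mono fun k =>
          Finset.le_sup (f := fun k => ENNReal.ofReal (γ k x)) (Finset.self_mem_range_succ k)
      · exact iSup_le fun N => Finset.sup_le fun k _ =>
          le_iSup (fun k => ENNReal.ofReal (γ k x)) k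
    rw [h1]
    exact (ENNReal.orderIsoRpow Q hQ).map_iSup _
  simp_rw [hsup]
  rw [lintegral_iSup (fun N => (hmeas N).pow_const Q)
    fun N M hNM x => ENNReal.rpow_le_rpow (hmono x hNM) hQ.le]
  refine iSup_le fun N => ?_
  -- Finite-valued simple minorants keep `S` below a real number, so a power of it can be divided
  -- out.
  rw [lintegral_eq_nnreal]
  refine iSup₂_le fun ψ hψ => ?_
  let E : ℕ → Set X := fun k => {x | (ψ x : ℝ≥0∞) ≤ ENNReal.ofReal (γ k x) ^ Q}
  have hE : ∀ k, MeasurableSet (E k) := fun k =>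
    measurableSet_le ψ.measurable.coe_nnreal_ennreal ((hγ k).ennreal_ofReal.pow_const Q)
  -- On `A (c, k)` the minorant equals `c` and `k` is the first index whose density dominates it, so
  -- `γ k ≥ c ^ Q⁻¹` when `c > 0`.
  let A : NNReal × ℕ → Set X := fun i => ψ ⁻¹' {i.1} ∩ disjointed E i.2
  have hA : ∀ i, MeasurableSet (A i) := fun i =>
    (ψ.measurableSet_preimage _).inter (MeasurableSet.disjointed hE _)
  have hd : Pairwise (Function.onFun Disjoint A) := by
    rintro ⟨c, k⟩ ⟨d, l⟩ hne
    refine Set.disjoint_left.2 fun x ⟨hx1, hx2⟩ ⟨hy1, hy2⟩ => hne ?_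
    have h1 : c = d := hx1.symm.trans hy1
    have h2 : k = l := by
      by_contra hkl
      exact Set.disjoint_left.1 (disjoint_disjointed E hkl) hx2 hy2
    rw [h1, h2]
  let s := ψ.range ×ˢ Finset.range (N + 1)
  set S : ℝ := ∑ i ∈ s, (i.1 : ℝ) * m.real (A i) with hS
  have hcover : (ψ.map ((↑) : NNReal → ℝ≥0∞)).lintegral m ≤ ENNReal.ofReal S := by
    rw [SimpleFunc.map_lintegral, hS, ENNReal.ofReal_sum_of_nonneg fun i _ => by positivity,
      Finset.sum_product]
    refine Finset.sum_le_sum fun c hc => ?_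
    have : (ψ ⁻¹' {c} : Set X) ⊆ ⋃ k ∈ Finset.range (N + 1), A (c, k) := by
      intro x hx
      obtain ⟨k, hk, hkx⟩ := Finset.exists_mem_eq_sup (Finset.range (N + 1))
        ⟨0, by simp⟩ fun k => ENNReal.ofReal (γ k x)
      have hxE : x ∈ ⋃ k ∈ Finset.range (N + 1), E k :=
        Set.mem_biUnion hk (by
          have := hψ x
          simp only [h] at this
          rw [hkx] at this
          exact this)
      have hxD : x ∈ ⋃ k ∈ Finset.range (N + 1), disjointed E k := by
        rw [biUnion_range_succ_disjointed, partialSups_eq_biSup]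
        simpa [Nat.lt_succ_iff] using hxE
      simp only [Set.mem_iUnion] at hxD ⊢
      obtain ⟨k, hk, hxk⟩ := hxD
      exact ⟨k, hk, hx, hxk⟩
    calc (c : ℝ≥0∞) * m (ψ ⁻¹' {c})
        ≤ c * ∑ k ∈ Finset.range (N + 1), m (A (c, k)) := by
          gcongr
          exact (measure_mono this).trans (measure_biUnion_finset_le _ _)
      _ = ∑ k ∈ Finset.range (N + 1), ENNReal.ofReal ((c : ℝ) * m.real (A (c, k))) := by
          rw [Finset.mul_sum]
          refine Finset.sum_congr rfl fun k _ => ?_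
          rw [ENNReal.ofReal_mul (NNReal.coe_nonneg c), measureReal_def,
            ENNReal.ofReal_toReal (measure_ne_top m _), ENNReal.ofReal_coe_nnreal]
  refine hcover.trans (ENNReal.ofReal_le_ofReal ?_)
  refine Real.le_rpow_of_le_mul_rpow hPQ (by positivity) (norm_nonneg Λ) ?_
  -- The extremal test function for Hölder: `c ^ P⁻¹` against a density at least `c ^ Q⁻¹` yields
  -- `c`, while the `p`-norm stays at most `S ^ P⁻¹`.
  let v : NNReal × ℕ → B := fun i => ((i.1 : ℝ) ^ P⁻¹) • u i.2
  have hterm : ∀ i ∈ s, (i.1 : ℝ) * m.real (A i) ≤ Λ (lpIndicator m p (hA i) (v i)) := by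
    rintro ⟨c, k⟩ -
    have h1 : lpIndicator m p (hA (c, k)) (v (c, k)) =
        ((c : ℝ) ^ P⁻¹) • lpIndicator m p (hA (c, k)) (u k) :=
      (lpIndicatorL m B p (hA (c, k))).map_smul _ _
    rw [h1, map_smul, smul_eq_mul, hΛ]
    rcases eq_or_ne c 0 with rfl | hc
    · simp [Real.zero_rpow (inv_ne_zero hP.ne')]
    have hc' : 0 < (c : ℝ) := by positivity
    have h2 : ∀ x ∈ A (c, k), (c : ℝ) ^ Q⁻¹ ≤ γ k x := by
      rintro x ⟨hx1, hx2⟩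
      have hx3 : (ψ x : ℝ≥0∞) ≤ ENNReal.ofReal (γ k x) ^ Q := disjointed_subset E k hx2
      have hx4 : ψ x = c := hx1
      rw [hx4] at hx3
      have hγ0 : 0 < γ k x := by
        by_contra! hneg
        rw [ENNReal.ofReal_of_nonpos hneg, ENNReal.zero_rpow_of_pos hQ] at hx3
        simp at hx3
        exact hc hx3
      rw [ENNReal.ofReal_rpow_of_pos hγ0, ← ENNReal.ofReal_coe_nnreal,
        ENNReal.ofReal_le_ofReal_iff (by positivity)] at hx3
      rw [Real.rpow_inv_le_iff_of_pos hc'.le hγ0.le hQ]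
      exact hx3
    calc (c : ℝ) * m.real (A (c, k))
        = (c : ℝ) ^ P⁻¹ * ((c : ℝ) ^ Q⁻¹ * m.real (A (c, k))) := by
          rw [← mul_assoc, ← Real.rpow_add hc', hPQ.inv_add_inv_eq_one, Real.rpow_one]
      _ ≤ _ := by
          gcongr
          exact setIntegral_ge_of_const_le_real (hA _) (measure_ne_top m _) h2
            (hγi k).integrableOn
  have hnorm : ‖∑ i ∈ s, lpIndicator m p (hA i) (v i)‖ ≤ S ^ P⁻¹ := by
    rw [Real.le_rpow_inv_iff_of_pos (norm_nonneg _) (by positivity) hP,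
      norm_sum_lpIndicator_rpow hp0 hp hA hd]
    refine Finset.sum_le_sum fun i _ => ?_
    gcongr
    calc ‖v i‖ ^ P ≤ ((i.1 : ℝ) ^ P⁻¹) ^ P := by
          gcongr
          rw [norm_smul, Real.norm_of_nonneg (by positivity)]
          exact mul_le_of_le_one_right (by positivity) (hu _)
      _ = i.1 := by
        rw [← Real.rpow_mul (NNReal.coe_nonneg i.1), inv_mul_cancel₀ hP.ne', Real.rpow_one]
  calc S ≤ ∑ i ∈ s, Λ (lpIndicator m p (hA i) (v i)) := Finset.sum_le_sum hterm
    _ = Λ (∑ i ∈ s, lpIndicator m p (hA i) (v i)) := (map_sum Λ _ _).symm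
    _ ≤ ‖Λ‖ * ‖∑ i ∈ s, lpIndicator m p (hA i) (v i)‖ :=
      (le_abs_self _).trans (Λ.le_opNorm _)
    _ ≤ ‖Λ‖ * S ^ P⁻¹ := by gcongr

end Maximal

/-! ### Functionals from countably many values. -/

/-- Rational bounds on finite combinations extend to real ones. -/
theorem abs_sum_mul_le_of_rat {B : Type*} [NormedAddCommGroup B] [NormedSpace ℝ B]
    {v : ℕ → B} {c : ℕ → ℝ} {M : ℝ}
    (h : ∀ (s : Finset ℕ) (r : ℕ → ℚ), |∑ i ∈ s, (r i : ℝ) * c i| ≤ M * ‖∑ i ∈ s, (r i : ℝ) • v i‖)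
    (s : Finset ℕ) (a : ℕ → ℝ) : |∑ i ∈ s, a i * c i| ≤ M * ‖∑ i ∈ s, a i • v i‖ := by
  have hdense : DenseRange fun (r : ℕ → ℚ) (i : ℕ) => (r i : ℝ) :=
    DenseRange.piMap fun _ => Rat.denseRange_cast
  refine hdense.induction_on (p := fun a => |∑ i ∈ s, a i * c i| ≤ M * ‖∑ i ∈ s, a i • v i‖) a ?_
    fun r => h s r
  exact isClosed_le (by fun_prop) (by fun_prop)

/-- **Helly's theorem** on prescribing the values of a continuous functional. -/
theorem exists_dual_apply_eq {B : Type*} [NormedAddCommGroup B] [NormedSpace ℝ B]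
    {v : ℕ → B} {c : ℕ → ℝ} {M : ℝ} (hM : 0 ≤ M)
    (h : ∀ (s : Finset ℕ) (a : ℕ → ℝ), |∑ i ∈ s, a i * c i| ≤ M * ‖∑ i ∈ s, a i • v i‖) :
    ∃ ω : StrongDual ℝ B, ‖ω‖ ≤ M ∧ ∀ i, ω (v i) = c i := by
  let T : (ℕ →₀ ℝ) →ₗ[ℝ] B := Finsupp.linearCombination ℝ v
  let S : (ℕ →₀ ℝ) →ₗ[ℝ] ℝ := Finsupp.linearCombination ℝ c
  have hTS : ∀ a, |S a| ≤ M * ‖T a‖ := fun a => by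
    simpa [S, T, Finsupp.linearCombination_apply, Finsupp.sum] using h a.support a
  -- The bound forces `ker T ≤ ker S`, so `S` factors through `T`.
  have hS : S ∈ LinearMap.range T.dualMap := by
    rw [LinearMap.range_dualMap_eq_dualAnnihilator_ker, Submodule.mem_dualAnnihilator]
    intro a ha
    have := hTS a
    rw [LinearMap.mem_ker.1 ha, norm_zero, mul_zero] at this
    exact abs_nonpos_iff.1 this
  obtain ⟨φ, hφ⟩ := hS
  have hφ' : ∀ a, φ (T a) = S a := fun a => LinearMap.congr_fun hφ a
  let ψ : StrongDual ℝ (LinearMap.range T) :=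
    (φ.comp (LinearMap.range T).subtype).mkContinuous M (by
      rintro ⟨_, a, rfl⟩
      simpa [hφ'] using hTS a)
  obtain ⟨ω, hω, hωn⟩ := exists_extension_norm_eq _ ψ
  refine ⟨ω, hωn.trans_le (LinearMap.mkContinuous_norm_le _ hM _), fun i => ?_⟩
  have h1 : T (Finsupp.single i 1) = v i := by simp [T]
  have h2 : S (Finsupp.single i 1) = c i := by simp [S]
  rw [← h1, ← h2, ← hφ']
  exact hω ⟨T (Finsupp.single i 1), LinearMap.mem_range_self _ _⟩

theorem Finsupp.sum_support_indicator {R M : Type*} [Zero R] [AddCommMonoid M] {f : ℕ → R → M}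
    (hf : ∀ i, f i 0 = 0) (s : Finset ℕ) (r : ℕ → R) :
    ∑ i ∈ (Finsupp.indicator s fun i _ => r i).support,
      f i (Finsupp.indicator s (fun i _ => r i) i) = ∑ i ∈ s, f i (r i) := by
  rw [Finset.sum_subset (Finsupp.support_indicator_subset s _) fun i _ hi => by
    rw [Finsupp.notMem_support_iff.1 hi, hf]]
  exact Finset.sum_congr rfl fun i hi => by rw [Finsupp.indicator_of_mem hi]

/-- The separable dual is Polish, and evaluation along a dense sequence is a continuous injection
into `ℕ → ℝ`. By Lusin–Souslin it is a measurable embedding, so measurability can be tested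
coordinatewise. -/
theorem stronglyMeasurable_of_measurable_apply {X : Type*} [MeasurableSpace X] {B : Type*}
    [NormedAddCommGroup B] [NormedSpace ℝ B]
    [TopologicalSpace.SeparableSpace (StrongDual ℝ B)] {v : ℕ → B} (hv : DenseRange v)
    {g : X → StrongDual ℝ B} (hg : ∀ i, Measurable fun x => g x (v i)) :
    StronglyMeasurable g := by
  borelize (StrongDual ℝ B)
  have : SecondCountableTopology (StrongDual ℝ B) :=
    UniformSpace.secondCountable_of_separable _
  have hev : Continuous fun (ω : StrongDual ℝ B) (i : ℕ) => ω (v i) := by fun_prop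
  have hinj : Function.Injective fun (ω : StrongDual ℝ B) (i : ℕ) => ω (v i) := fun ω η h =>
    ContinuousLinearMap.coeFn_injective
      (hv.equalizer ω.continuous η.continuous (funext fun i => congr_fun h i))
  refine Measurable.stronglyMeasurable ?_
  exact (hev.measurableEmbedding hinj).measurable_comp_iff.1 (measurable_pi_iff.2 hg)

/-! ### Functionals on `Lp B p m` as `Lp` functions with values in the dual. -/

section Duality

variable {X : Type*} [MeasurableSpace X] {m : Measure X} [IsFiniteMeasure m]
  {B : Type*} [NormedAddCommGroup B] [NormedSpace ℝ B] {p q : ℝ≥0∞}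

/-- The action on `Lp B p m` of a function in `Lp (StrongDual ℝ B) q m`. -/
noncomputable abbrev lpDualPairing (m : Measure X) (B : Type*) [NormedAddCommGroup B]
    [NormedSpace ℝ B] (p q : ℝ≥0∞) [Fact (1 ≤ p)] [Fact (1 ≤ q)] [q.HolderConjugate p] :
    Lp (StrongDual ℝ B) q m →L[ℝ] StrongDual ℝ (Lp B p m) :=
  (ContinuousLinearMap.id ℝ (StrongDual ℝ B)).lpPairing m q p

/-- A functional on `Lp B p m` is represented by a pointwise functional obtained from
the densities in the directions of a dense sequence. -/
theorem exists_pointwise_functional [Fact (1 ≤ p)] [p.HolderConjugate q] (hp1 : 1 < p)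
    (hp : p ≠ ∞) (Λ : StrongDual ℝ (Lp B p m)) (v : ℕ → B) :
    ∃ (g : X → StrongDual ℝ B) (h : X → ℝ≥0∞), (∀ i, Measurable fun x => g x (v i)) ∧
      (∀ x, ‖g x‖ₑ ≤ h x) ∧ ∫⁻ x, h x ^ q.toReal ∂m < ∞ ∧
      ∀ i (A : Set X) (hA : MeasurableSet A),
        Λ (lpIndicator m p hA (v i)) = ∫ x in A, g x (v i) ∂m := by
  classical
  choose γ hγ hγi hΛ using exists_density hp Λ
  obtain ⟨e, he⟩ := exists_surjective_nat (ℕ →₀ ℚ)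
  let w : (ℕ →₀ ℚ) → B := fun r => ∑ i ∈ r.support, (r i : ℝ) • v i
  -- If `w r = 0`, then `u r = 0`, so the norm bound and `‖w r‖ • u r = w r` hold without exception.
  let u : (ℕ →₀ ℚ) → B := fun r => ‖w r‖⁻¹ • w r
  have hu : ∀ r, ‖u r‖ ≤ 1 := fun r => by
    rw [norm_smul, norm_inv, norm_norm]
    exact inv_mul_le_one
  let h : X → ℝ≥0∞ := fun x => ⨆ k, ENNReal.ofReal (γ (u (e k)) x)
  have hmax := lintegral_iSup_density_rpow_le (q := q) hp1 hp Λ (fun k => hu (e k))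
    (fun k => hγ (u (e k))) (fun k => hγi _) (fun k => hΛ _)
  have hlt : ∫⁻ x, h x ^ q.toReal ∂m < ∞ := hmax.trans_lt ENNReal.ofReal_lt_top
  have hQ : 0 < q.toReal := (ENNReal.HolderConjugate.toReal_of_one_lt hp1 hp).symm.pos
  have hfin : ∀ᵐ x ∂m, h x < ∞ := by
    have hm : Measurable fun x => h x ^ q.toReal :=
      (Measurable.iSup fun k => (hγ _).ennreal_ofReal).pow_const _
    filter_upwards [ae_lt_top hm hlt.ne] with x hx
    exact (ENNReal.rpow_lt_top_iff_of_pos hQ).1 hx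
  -- Each linear relation holds only almost everywhere; there are countably many rational `r`, so
  -- one null set serves them all.
  have hlin : ∀ r : ℕ →₀ ℚ, ∀ᵐ x ∂m,
      ∑ i ∈ r.support, (r i : ℝ) * γ (v i) x = ‖w r‖ * γ (u r) x := by
    intro r
    refine Integrable.ae_eq_of_forall_setIntegral_eq _ _
      (integrable_finsetSum _ fun i _ => (hγi _).const_mul _) ((hγi _).const_mul _)
      fun A hA _ => ?_
    rw [integral_finsetSum _ fun i _ => ((hγi _).const_mul _).integrableOn, integral_const_mul,
      ← hΛ _ A hA, ← smul_eq_mul, ← map_smul, ← lpIndicatorL_apply, ← map_smul]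
    have hw : ‖w r‖ • u r = w r := by
      rcases eq_or_ne (w r) 0 with h0 | h0
      · simp [u, h0]
      · simp only [u]
        rw [smul_smul, mul_inv_cancel₀ (norm_ne_zero_iff.2 h0), one_smul]
    rw [hw]
    simp only [w, map_sum, map_smul, lpIndicatorL_apply, hΛ, integral_const_mul, smul_eq_mul]
  have hgood : ∀ᵐ x ∂m, h x < ∞ ∧ ∀ r : ℕ →₀ ℚ,
      ∑ i ∈ r.support, (r i : ℝ) * γ (v i) x = ‖w r‖ * γ (u r) x :=
    hfin.and (ae_all_iff.2 hlin)
  have hex : ∀ x, (h x < ∞ ∧ ∀ r : ℕ →₀ ℚ,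
      ∑ i ∈ r.support, (r i : ℝ) * γ (v i) x = ‖w r‖ * γ (u r) x) →
      ∃ ω : StrongDual ℝ B, ‖ω‖ ≤ (h x).toReal ∧ ∀ i, ω (v i) = γ (v i) x := by
    rintro x ⟨hx, hr⟩
    refine exists_dual_apply_eq ENNReal.toReal_nonneg (abs_sum_mul_le_of_rat fun s r => ?_)
    have hone : ∀ r : ℕ →₀ ℚ, ∑ i ∈ r.support, (r i : ℝ) * γ (v i) x ≤ (h x).toReal * ‖w r‖ := by
      intro r
      obtain ⟨k, rfl⟩ := he r
      rw [hr, mul_comm]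
      gcongr
      refine (ENNReal.ofReal_le_iff_le_toReal hx.ne).1 ?_
      exact le_iSup (fun k => ENNReal.ofReal (γ (u (e k)) x)) k
    have hs1 : ∀ r : ℕ → ℚ, ∑ i ∈ s, (r i : ℝ) * γ (v i) x ≤
        (h x).toReal * ‖∑ i ∈ s, (r i : ℝ) • v i‖ := fun r => by
      have := hone (Finsupp.indicator s fun i _ => r i)
      rwa [Finsupp.sum_support_indicator (f := fun i (t : ℚ) => (t : ℝ) * γ (v i) x) (by simp),
        show w (Finsupp.indicator s fun i _ => r i) = _ from
          Finsupp.sum_support_indicator (f := fun i (t : ℚ) => (t : ℝ) • v i) (by simp) s r] at this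
    refine abs_le'.2 ⟨hs1 r, ?_⟩
    have := hs1 (-r)
    simpa [Finset.sum_neg_distrib] using this
  obtain ⟨N, hN, hNm, hN0⟩ := exists_measurable_superset_of_null (ae_iff.1 hgood)
  have hNg : ∀ x, x ∉ N → _ := fun x hx => hex x (not_not.1 fun hcon => hx (hN hcon))
  choose! ω hω1 hω2 using hNg
  have hNae : ∀ᵐ x ∂m, x ∉ N := measure_eq_zero_iff_ae_notMem.1 hN0
  have hgv : ∀ i x, (Nᶜ.indicator ω x) (v i) = Nᶜ.indicator (γ (v i)) x := fun i x => by
    by_cases hx : x ∈ N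
    · simp [hx]
    · simp [hx, hω2 x hx i]
  refine ⟨Nᶜ.indicator ω, h, fun i => ?_, fun x => ?_, hlt, fun i A hA => ?_⟩
  · simp only [hgv]
    exact (hγ _).indicator hNm.compl
  · by_cases hx : x ∈ N
    · rw [Set.indicator_of_notMem (not_not.2 hx), ← ofReal_norm, norm_zero, ENNReal.ofReal_zero]
      exact bot_le
    · rw [Set.indicator_of_mem (show x ∈ Nᶜ from hx), ← ofReal_norm]
      exact (ENNReal.ofReal_le_ofReal (hω1 x hx)).trans ENNReal.ofReal_toReal_le
  · rw [hΛ]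
    refine integral_congr_ae (ae_restrict_of_ae ?_)
    filter_upwards [hNae] with x hx
    rw [hgv, Set.indicator_of_mem (show x ∈ Nᶜ from hx)]

/-- The dual of `Lp B p m` is `Lp (StrongDual ℝ B) q m` when `B` and its dual are separable. -/
theorem lpDualPairing_surjective [TopologicalSpace.SeparableSpace B]
    [TopologicalSpace.SeparableSpace (StrongDual ℝ B)] [Fact (1 ≤ p)] [Fact (1 ≤ q)]
    [p.HolderConjugate q] [q.HolderConjugate p] (hp1 : 1 < p) (hp : p ≠ ∞) (hq : q ≠ ∞) :
    Function.Surjective (lpDualPairing m B p q) := by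
  intro Λ
  have hv := TopologicalSpace.denseRange_denseSeq B
  obtain ⟨g, h, hgm, hgh, hlt, hΛ⟩ := exists_pointwise_functional (q := q) hp1 hp Λ
    (TopologicalSpace.denseSeq B)
  have hq0 : q ≠ 0 := (zero_lt_one.trans_le Fact.out).ne'
  have hgq : MemLp g q m := by
    refine ⟨(stronglyMeasurable_of_measurable_apply hv hgm).aestronglyMeasurable, ?_⟩
    rw [eLpNorm_lt_top_iff_lintegral_rpow_enorm_lt_top hq0 hq]
    refine lt_of_le_of_lt (lintegral_mono fun x => ?_) hlt
    exact ENNReal.rpow_le_rpow (hgh x) ENNReal.toReal_nonneg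
  refine ⟨hgq.toLp g, ?_⟩
  set Λ' := lpDualPairing m B p q (hgq.toLp g)
  have hind : ∀ (A : Set X) (hA : MeasurableSet A) (b : B),
      Λ' (lpIndicator m p hA b) = Λ (lpIndicator m p hA b) := by
    intro A hA b
    refine hv.induction_on (p := fun b => Λ' (lpIndicatorL m B p hA b) =
      Λ (lpIndicatorL m B p hA b)) b (isClosed_eq (by fun_prop) (by fun_prop)) fun i => ?_
    rw [lpIndicatorL_apply, hΛ]
    simp only [Λ', lpDualPairing, ContinuousLinearMap.lpPairing_eq_integral]
    rw [← integral_indicator hA]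
    refine integral_congr_ae ?_
    filter_upwards [hgq.coeFn_toLp, indicatorConstLp_coeFn (p := p) (hs := hA)
      (hμs := measure_ne_top m A) (c := TopologicalSpace.denseSeq B i)] with x h1 h2
    rw [h1, h2]
    by_cases hx : x ∈ A <;> simp [hx]
  ext f
  refine Lp.induction hp (motive := fun f => Λ' f = Λ f) (fun b A hA _ => hind A hA b) ?_
    (isClosed_eq (by fun_prop) (by fun_prop)) f
  intro f₁ f₂ h₁ h₂ _ e₁ e₂
  rw [map_add, map_add, e₁, e₂]

end Duality

/-! ### Reflexivity of `Lp B p m` and its converse. -/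

section Reflexive

variable {X : Type*} [MeasurableSpace X] {m : Measure X}
  {B : Type*} [NormedAddCommGroup B] [NormedSpace ℝ B]

theorem IsReflexiveSpace.lp_of_separableSpace [IsFiniteMeasure m]
    [TopologicalSpace.SeparableSpace B] (hB : IsReflexiveSpace B) (p : ℝ≥0∞) [Fact (1 ≤ p)]
    (hp1 : 1 < p) (hp : p ≠ ∞) : IsReflexiveSpace (Lp B p m) := by
  have := hB.separableSpace_dual
  have hsep : TopologicalSpace.SeparableSpace (StrongDual ℝ (StrongDual ℝ B)) :=
    hB.denseRange.separableSpace (NormedSpace.inclusionInDoubleDual ℝ B).continuous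
  let q := p.conjExponent
  have hqp : q.HolderConjugate p := ENNReal.HolderConjugate.symm
  have hq1 : 1 < q := (ENNReal.HolderConjugate.lt_top_iff_one_lt p q).1 hp.lt_top
  have hq : q ≠ ∞ := ((ENNReal.HolderConjugate.lt_top_iff_one_lt q p).2 hp1).ne
  have : Fact (1 ≤ q) := ⟨hq1.le⟩
  have hJ := lpDualPairing_surjective (m := m) (B := B) (p := p) (q := q) hp1 hp hq
  have hK := lpDualPairing_surjective (m := m) (B := StrongDual ℝ B) (p := q) (q := p) hq1 hq hp
  intro Φ
  obtain ⟨U, hU⟩ := hK (Φ.comp (lpDualPairing m B p q))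
  let e := LinearIsometryEquiv.ofSurjective (NormedSpace.inclusionInDoubleDualLi ℝ) hB
  let E : StrongDual ℝ (StrongDual ℝ B) →L[ℝ] B := e.symm.toContinuousLinearEquiv
  have hE : ∀ (φ : StrongDual ℝ (StrongDual ℝ B)) (ω : StrongDual ℝ B), ω (E φ) = φ ω := by
    intro φ ω
    have : NormedSpace.inclusionInDoubleDual ℝ B (E φ) = φ := e.apply_symm_apply φ
    rw [← NormedSpace.dual_def, this]
  refine ⟨E.compLp U, ?_⟩
  ext Λ
  -- Every functional comes from some `g`, so it suffices to compare the two sides on pairings,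
  -- where both are integrals of `U x (g x)`.
  obtain ⟨g, rfl⟩ := hJ Λ
  have h1 : Φ (lpDualPairing m B p q g) = lpDualPairing m (StrongDual ℝ B) q p U g := by
    rw [hU]; rfl
  rw [NormedSpace.dual_def, h1]
  simp only [lpDualPairing, ContinuousLinearMap.lpPairing_eq_integral]
  refine integral_congr_ae ?_
  filter_upwards [E.coeFn_compLp U] with x hx
  rw [hx]
  exact hE _ _

/-- Countably many elements of `Lp B p m` take their values in a separable closed subspace. -/
theorem exists_separable_submodule_forall_eq_compLp {p : ℝ≥0∞} (x : ℕ → Lp B p m) :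
    ∃ S : Submodule ℝ B, IsClosed (S : Set B) ∧ TopologicalSpace.SeparableSpace S ∧
      ∃ y : ℕ → Lp S p m, ∀ n, ‖y n‖ = ‖x n‖ ∧ S.subtypeL.compLp (y n) = x n := by
  let S : Submodule ℝ B := (Submodule.span ℝ (⋃ n, Set.range (x n))).topologicalClosure
  have hsep : TopologicalSpace.IsSeparable (S : Set B) :=
    ((TopologicalSpace.IsSeparable.iUnion fun n =>
      (Lp.stronglyMeasurable (x n)).isSeparable_range).span).closure
  have hmem : ∀ n a, x n a ∈ S := fun n a => Submodule.le_topologicalClosure _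
    (Submodule.subset_span (Set.mem_iUnion.2 ⟨n, a, rfl⟩))
  let z : ℕ → X → S := fun n a => ⟨x n a, hmem n a⟩
  have hz : ∀ n, MemLp (z n) p m := fun n => by
    refine (Lp.memLp (x n)).of_le ?_ (Filter.Eventually.of_forall fun a => le_rfl)
    exact ((Embedding.comp_stronglyMeasurable_iff Topology.IsEmbedding.subtypeVal).1
      (Lp.stronglyMeasurable (x n))).aestronglyMeasurable
  refine ⟨S, Submodule.isClosed_topologicalClosure _, hsep.separableSpace,
    fun n => (hz n).toLp (z n), fun n => ⟨?_, ?_⟩⟩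
  · rw [Lp.norm_toLp, Lp.norm_def]
    rfl
  · ext1
    filter_upwards [S.subtypeL.coeFn_compLp ((hz n).toLp (z n)), (hz n).coeFn_toLp] with a h1 h2
    rw [h1, h2]
    rfl

theorem IsReflexiveSpace.lp [IsFiniteMeasure m] [CompleteSpace B] (hB : IsReflexiveSpace B)
    (p : ℝ≥0∞) [Fact (1 ≤ p)] (hp1 : 1 < p) (hp : p ≠ ∞) : IsReflexiveSpace (Lp B p m) := by
  refine isReflexiveSpace_of_forall_bounded_seq fun x ⟨C, hC⟩ => ?_
  obtain ⟨S, hS, hsep, y, hy⟩ := exists_separable_submodule_forall_eq_compLp x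
  exact ⟨Lp S p m, inferInstance, inferInstance,
    (hB.submodule S hS).lp_of_separableSpace p hp1 hp, S.subtypeL.compLpL p m, y,
    ⟨C, fun n => (hy n).1.trans_le (hC n)⟩, fun n => (hy n).2⟩

/-- A retract of a reflexive space is reflexive. -/
theorem IsReflexiveSpace.of_retract {E F : Type*} [NormedAddCommGroup E] [NormedSpace ℝ E]
    [NormedAddCommGroup F] [NormedSpace ℝ F] (hE : IsReflexiveSpace E) (i : F →L[ℝ] E)
    (r : E →L[ℝ] F) (hri : ∀ b, r (i b) = b) : IsReflexiveSpace F := by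
  intro φ
  obtain ⟨u, hu⟩ := hE (φ.comp (ContinuousLinearMap.precomp ℝ i))
  refine ⟨r u, ?_⟩
  ext ω
  have h1 : (ω.comp r).comp i = ω := by ext b; simp [hri]
  have h2 : (ω.comp r) u = φ ((ω.comp r).comp i) := by
    rw [← NormedSpace.dual_def, hu]; rfl
  rw [h1] at h2
  exact h2

theorem IsReflexiveSpace.of_lp_two [IsProbabilityMeasure m] [CompleteSpace B]
    (h : IsReflexiveSpace (Lp B 2 m)) : IsReflexiveSpace B := by
  -- The retraction is the mean, written as the pairing with the constant `1`; the exponent `2` is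
  -- its own conjugate.
  refine h.of_retract (Lp.constL 2 m ℝ)
    ((ContinuousLinearMap.lsmul ℝ ℝ).lpPairing m 2 2 (Lp.const 2 m (1 : ℝ))) fun b => ?_
  rw [ContinuousLinearMap.lpPairing_eq_integral]
  have : (fun x => ContinuousLinearMap.lsmul ℝ ℝ (Lp.const 2 m (1 : ℝ) x)
      ((Lp.constL 2 m ℝ b : Lp B 2 m) x)) =ᵐ[m] fun _ => b := by
    filter_upwards [Lp.coeFn_const (p := 2) (μ := m) (1 : ℝ),
      Lp.coeFn_const (p := 2) (μ := m) b] with x h1 h2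
    rw [h1, Lp.constL_apply, h2]
    simp
  rw [integral_congr_ae this]
  simp

end Reflexive

theorem theoremA1 {X : Type*} [MeasurableSpace X] (m : Measure X) [IsProbabilityMeasure m]
    (B : Type*) [NormedAddCommGroup B] [NormedSpace ℝ B] [CompleteSpace B] :
    IsReflexiveSpace B ↔
      ∀ (p : ℝ≥0∞) [Fact (1 ≤ p)], 1 < p → p < ∞ → IsReflexiveSpace (Lp B p m) :=
  ⟨fun hB p _ hp1 hp => hB.lp p hp1 hp.ne,
    fun h => (h 2 ENNReal.one_lt_two ENNReal.ofNat_lt_top).of_lp_two⟩
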